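/- Let $X=\mathbb{P}^1$ be the complex projective line, let $d\ge 4$, let $E=\mathcal{O}(d)\to X$ be the $d$-th power of the hyperplane section bundle, and let $h$ be any smooth hermitian metric on $E$. Let $\omega=-i\,\partial\overline\partial\log h(e,e)$ ($e$ any nonvanishing local holomorphic section of $E$), so that the curvature form of $h$ is $-i\omega$. Let $C^\infty(X)$ be the space of smooth functions $X\to\mathbb{R}$ with its Fréchet topology (uniform convergence of all derivatives), and let $$\mathcal{H}_\omega=\{u\in C^\infty(X):\ \omega+i\partial\overline\partial u>0\}$$ carry the subspace topology. Let $\mathcal{O}(E)$ be the space of holomorphic sections of $E$ and $\mathcal{H}_E$ the set of positive definite hermitian inner products on $\mathcal{O}(E)$. For $\langle\,,\rangle\in\mathcal{H}_E$ put $$\mathrm{FS}(\langle\,,\rangle)=\log\kappa,\qquad \kappa(x)=\sup\Big\{\frac{h(s(x),s(x))}{\langle s,s\rangle}:\ s\in\mathcal{O}(E)\setminus\{0\}\Big\},\quad x\in X .$$ Then $\mathrm{FS}$ maps $\mathcal{H}_E$ into $\mathcal{H}_\omega$, but $\mathrm{FS}(\mathcal{H}_E)$ is not a relatively closed subset of $\mathcal{H}_\omega$.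 More precisely, in the standard trivialization of $E$ over $\mathbb{C}=\mathbb{P}^1\setminus\{\infty\}$ the monomials $1,z,z^2,\dots,z^d$ represent sections $s_0,\dots,s_d$ that form a basis of $\mathcal{O}(E)$. For $t>0$ let $\langle\,,\rangle_t\in\mathcal{H}_E$ be the inner product for which $s_0,s_1,ts_2,s_3,\dots,s_d$ (that is, $1,z,tz^2,z^3,\dots,z^d$) form an orthonormal basis. As $t\to0^+$, the functions $\mathrm{FS}(\langle\,,\rangle_t)$ converge in $\mathcal{H}_\omega$ to $$u_0=\log\sum_{0\le j\le d,\ j\ne2}h(s_j,s_j)\in\mathcal{H}_\omega ,$$ and $u_0\notin\mathrm{FS}(\mathcal{H}_E)$. -/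

import Mathlib

open scoped Manifold ContDiff Bundle Topology LinearAlgebra.Projectivization

noncomputable section

namespace FubiniStudy

/-! ### Hermitian holomorphic line bundles over one-dimensional complex manifolds -/

section General

variable {X : Type*} [TopologicalSpace X] [ChartedSpace ℂ X]

/-- `C^∞(X)`: smooth functions `X → ℝ`, where `X` is viewed as a real manifold. -/
abbrev SmoothFun (X : Type*) [TopologicalSpace X] [ChartedSpace ℂ X] : Type _ :=
  C^∞⟮𝓘(ℝ, ℂ), X; 𝓘(ℝ, ℝ), ℝ⟯

/-- The Fréchet topology of `C^∞(X)`: uniform convergence of the derivatives of all orders, in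
each chart of the atlas, on the compact subsets of the image of the chart. -/
instance smoothFunTopology : TopologicalSpace (SmoothFun X) :=
  ⨅ (e ∈ atlas ℂ X) (n : ℕ), TopologicalSpace.induced
    (fun u : SmoothFun X =>
      UniformOnFun.ofFun {K : Set ℂ | IsCompact K ∧ K ⊆ e.target}
        (iteratedFDeriv ℝ n (fun z : ℂ => u (e.symm z))))
    inferInstance

/-- The real `(1,1)`-form `i ∂∂̄ f` on an open subset of `ℂ`, at the point `p`, evaluated on the
real tangent vectors `v, w`:  `(i ∂∂̄ f)(v, w) = (D²f(iv, w) - D²f(v, iw)) / 2`,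
that is, `i (∂²f/∂z∂z̄) dz ∧ dz̄ = ½ (f_xx + f_yy) dx ∧ dy`. -/
def iddbarPlane (f : ℂ → ℝ) (p v w : ℂ) : ℝ :=
  (fderiv ℝ (fderiv ℝ f) p (Complex.I * v) w - fderiv ℝ (fderiv ℝ f) p v (Complex.I * w)) / 2

/-- The real `(1,1)`-form `i ∂∂̄ f` on `X`. It is computed in the preferred chart at `x`, the chart
through which the tangent space at `x` is identified with `ℂ`. -/
def iddbar (f : X → ℝ) (x : X) (v w : TangentSpace 𝓘(ℂ, ℂ) x) : ℝ :=
  iddbarPlane (fun z => f ((chartAt ℂ x).symm z)) (chartAt ℂ x x) v w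

variable {E : X → Type*} [TopologicalSpace (Bundle.TotalSpace ℂ E)]
  [∀ x, TopologicalSpace (E x)] [∀ x, AddCommGroup (E x)] [∀ x, Module ℂ (E x)]
  [FiberBundle ℂ E] [VectorBundle ℂ ℂ E] [ContMDiffVectorBundle ω ℂ E 𝓘(ℂ, ℂ)]

/-- The nonvanishing holomorphic local section of the line bundle `E` given by the preferred
trivialization near `x₀` (meaningful on the base set of that trivialization). -/
def frame (E : X → Type*) [TopologicalSpace (Bundle.TotalSpace ℂ E)]
    [∀ x, TopologicalSpace (E x)] [∀ x, AddCommGroup (E x)] [∀ x, Module ℂ (E x)]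
    [FiberBundle ℂ E] (x₀ x : X) : E x :=
  (trivializationAt ℂ E x₀).symm x 1

/-- A (smooth) hermitian metric on a holomorphic line bundle `E → X`: a positive definite hermitian
inner product `h` on every fiber, such that `h(e, e)` is smooth for the local frames `e`. -/
structure HermitianMetric (E : X → Type*) [TopologicalSpace (Bundle.TotalSpace ℂ E)]
    [∀ x, TopologicalSpace (E x)] [∀ x, AddCommGroup (E x)] [∀ x, Module ℂ (E x)]
    [FiberBundle ℂ E] where
  inner : ∀ x, InnerProductSpace.Core ℂ (E x)
  smooth : ∀ x₀, ContMDiffOn 𝓘(ℝ, ℂ) 𝓘(ℝ, ℝ) ∞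
    (fun x => ((inner x).inner (frame E x₀ x) (frame E x₀ x)).re)
    (trivializationAt ℂ E x₀).baseSet

/-- The squared length `h(v, v)` of a vector `v ∈ E x`. -/
def HermitianMetric.normSq (h : HermitianMetric E) {x : X} (v : E x) : ℝ :=
  ((h.inner x).inner v v).re

/-- The space `𝓞(E)` of holomorphic sections of `E`. -/
abbrev HolSection (E : X → Type*) [TopologicalSpace (Bundle.TotalSpace ℂ E)]
    [∀ x, TopologicalSpace (E x)] [∀ x, AddCommGroup (E x)] [∀ x, Module ℂ (E x)]
    [FiberBundle ℂ E] [VectorBundle ℂ ℂ E] : Type _ :=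
  Cₛ^ω⟮𝓘(ℂ, ℂ); ℂ, E⟯

/-- The set `𝓗_E` of positive definite (hermitian) inner products on `𝓞(E)`. -/
abbrev InnerProducts (E : X → Type*) [TopologicalSpace (Bundle.TotalSpace ℂ E)]
    [∀ x, TopologicalSpace (E x)] [∀ x, AddCommGroup (E x)] [∀ x, Module ℂ (E x)]
    [FiberBundle ℂ E] [VectorBundle ℂ ℂ E] : Type _ :=
  InnerProductSpace.Core ℂ (HolSection E)

/-- The form `ω = -i ∂∂̄ log h(e, e)`, `e` a nonvanishing local holomorphic section; the curvature
form of (the Chern connection of) `h` is `-∂∂̄ log h(e, e) = -i ω`. -/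
def HermitianMetric.omega (h : HermitianMetric E) (x : X) (v w : TangentSpace 𝓘(ℂ, ℂ) x) : ℝ :=
  -iddbar (fun y => Real.log (h.normSq (frame E x y))) x v w

/-- `𝓗_ω = {u ∈ C^∞(X) : ω + i ∂∂̄ u > 0}`. A real `(1,1)`-form `η` is positive at `x` if
`η(v, Jv) > 0` for all nonzero tangent vectors `v` at `x`, with `J` multiplication by `i`. -/
def HermitianMetric.potentials (h : HermitianMetric E) : Set (SmoothFun X) :=
  {u | ∀ (x : X) (v : TangentSpace 𝓘(ℂ, ℂ) x), v ≠ 0 →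
    0 < h.omega x v (Complex.I • v) + iddbar u x v (Complex.I • v)}

/-- The Bergman function `κ(x) = sup {h(s(x), s(x)) / ⟨s, s⟩ : s ∈ 𝓞(E) ∖ {0}}`. -/
def bergman (h : HermitianMetric E) (ip : InnerProducts E) (x : X) : ℝ :=
  sSup {r : ℝ | ∃ s : HolSection E, s ≠ 0 ∧ r = h.normSq (s x) / (ip.inner s s).re}

/-- The Fubini–Study map `FS(⟨ , ⟩) = log κ`. -/
def fubiniStudy (h : HermitianMetric E) (ip : InnerProducts E) (x : X) : ℝ :=
  Real.log (bergman h ip x)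

/-- The image `FS(𝓗_E)` as a subset of `C^∞(X)`. -/
def fubiniStudyRange (h : HermitianMetric E) : Set (SmoothFun X) :=
  {u | ∃ ip : InnerProducts E, ∀ x, u x = fubiniStudy h ip x}

end General

/-! ### The projective line -/

/-- The complex projective line, the set of lines through `0` in `ℂ²`. -/
abbrev P1 : Type := ℙ ℂ (Fin 2 → ℂ)

/-- The quotient topology from `ℂ² ∖ {0}`. -/
instance : TopologicalSpace P1 :=
  TopologicalSpace.coinduced (Projectivization.mk' ℂ : {v : Fin 2 → ℂ // v ≠ 0} → P1) inferInstance

/-- The quotient `v i / v j` of homogeneous coordinates of `x = [v]`. -/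
def ratio (i j : Fin 2) (x : P1) : ℂ :=
  Projectivization.lift (fun v : {v : Fin 2 → ℂ // v ≠ 0} => v.1 i / v.1 j)
    (by
      rintro a b t hab
      have ht : t ≠ 0 := by
        rintro rfl
        exact a.2 (by simpa using hab)
      have hi : ∀ k, a.1 k = t * b.1 k := fun k => by rw [hab]; rfl
      simp only [hi]
      exact mul_div_mul_left _ _ ht) x

/-- The open set where the `i`-th homogeneous coordinate does not vanish (`v i / v i` is `1` if
`v i ≠ 0`, and `0` otherwise). -/
def affine (i : Fin 2) : Set P1 := {x | ratio i i x = 1}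

/-- The point of `affine i` with affine coordinate `z`: `[z : 1]` if `i = 1`, `[1 : z]` if
`i = 0`. -/
def affinePoint (i : Fin 2) (z : ℂ) : P1 :=
  Projectivization.mk ℂ (fun k => if k = i then 1 else z)
    (fun h => one_ne_zero (α := ℂ) (by simpa using congrFun h i))

theorem ratio_mk (i j : Fin 2) (v : Fin 2 → ℂ) (hv : v ≠ 0) :
    ratio i j (Projectivization.mk ℂ v hv) = v i / v j := rfl

theorem mk_mem_affine (i : Fin 2) (v : Fin 2 → ℂ) (hv : v ≠ 0) :
    Projectivization.mk ℂ v hv ∈ affine i ↔ v i ≠ 0 := by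
  change v i / v i = 1 ↔ v i ≠ 0
  constructor
  · intro h h0
    simp [h0] at h
  · exact fun h => div_self h

theorem continuous_mk' :
    Continuous (Projectivization.mk' ℂ : {v : Fin 2 → ℂ // v ≠ 0} → P1) :=
  continuous_coinduced_rng

theorem isOpen_affine (i : Fin 2) : IsOpen (affine i) := by
  change IsOpen ((Projectivization.mk' ℂ : {v : Fin 2 → ℂ // v ≠ 0} → P1) ⁻¹' affine i)
  have : (Projectivization.mk' ℂ : {v : Fin 2 → ℂ // v ≠ 0} → P1) ⁻¹' affine i
      = {v | v.1 i ≠ 0} := by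
    ext v
    exact mk_mem_affine i v.1 v.2
  rw [this]
  exact isOpen_ne_fun ((continuous_apply i).comp continuous_subtype_val) continuous_const

theorem continuousOn_ratio (i j : Fin 2) : ContinuousOn (ratio i j) (affine j) := by
  rw [(isOpen_affine j).continuousOn_iff]
  intro x hx
  induction x using Projectivization.ind with
  | h v hv =>
    have hq : Topology.IsQuotientMap
        (Projectivization.mk' ℂ : {v : Fin 2 → ℂ // v ≠ 0} → P1) :=
      ⟨⟨rfl⟩, Quotient.mk''_surjective⟩
    have : ContinuousOn (ratio i j) (affine j) := by
      rw [hq.continuousOn_isOpen_iff (isOpen_affine j)]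
      intro w hw
      have hw' : w.1 j ≠ 0 := (mk_mem_affine j w.1 w.2).1 hw
      change ContinuousWithinAt (fun w : {v : Fin 2 → ℂ // v ≠ 0} => w.1 i / w.1 j) _ _
      exact (ContinuousAt.div ((continuous_apply i).comp continuous_subtype_val).continuousAt
        ((continuous_apply j).comp continuous_subtype_val).continuousAt hw').continuousWithinAt
    exact this.continuousAt ((isOpen_affine j).mem_nhds hx)

theorem continuous_affinePoint (i : Fin 2) : Continuous (affinePoint i) := by
  refine continuous_mk'.comp (f := fun z : ℂ =>
    (⟨fun k => if k = i then 1 else z,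
      fun h => one_ne_zero (α := ℂ) (by simpa using congrFun h i)⟩ :
        {v : Fin 2 → ℂ // v ≠ 0})) ?_
  refine Continuous.subtype_mk (continuous_pi fun k => ?_) _
  split_ifs <;> fun_prop

/-- The affine coordinate `v (1 - i) / v i` on `affine i`, with inverse `affinePoint i`. -/
def chart (i : Fin 2) : OpenPartialHomeomorph P1 ℂ where
  toFun := ratio i.rev i
  invFun := affinePoint i
  source := affine i
  target := Set.univ
  map_source' _ _ := Set.mem_univ _
  map_target' z _ := (mk_mem_affine i _ _).2 (by simp)
  left_inv' := by
    intro x hx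
    induction x using Projectivization.ind with
    | h v hv =>
      have hi : v i ≠ 0 := (mk_mem_affine i v hv).1 hx
      refine (Projectivization.mk_eq_mk_iff' ℂ _ _ _ _).2 ⟨(v i)⁻¹, ?_⟩
      funext k
      change (v i)⁻¹ * v k = if k = i then 1 else v i.rev / v i
      fin_cases i <;> fin_cases k <;> simp_all [div_eq_inv_mul]
  right_inv' := by
    intro z _
    change (if i.rev = i then (1 : ℂ) else z) / (if i = i then 1 else z) = z
    fin_cases i <;> simp
  open_source := isOpen_affine i
  open_target := isOpen_univ
  continuousOn_toFun := continuousOn_ratio _ _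
  continuousOn_invFun := (continuous_affinePoint i).continuousOn

open Classical in
/-- `1` on the affine line `{[z : 1]}`, and `0` at the remaining point `[1 : 0]`. -/
def indexAt (x : P1) : Fin 2 := if x ∈ affine 1 then 1 else 0

theorem mem_affine_indexAt (x : P1) : x ∈ affine (indexAt x) := by
  unfold indexAt
  split_ifs with h
  · exact h
  · induction x using Projectivization.ind with
    | h v hv =>
      rw [mk_mem_affine] at h ⊢
      intro h0
      apply hv
      funext k
      fin_cases k
      · exact h0
      · simpa using h

/-- The complex structure of the projective line, with the two affine charts. -/
instance : ChartedSpace ℂ P1 where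
  atlas := Set.range chart
  chartAt x := chart (indexAt x)
  mem_chart_source := mem_affine_indexAt
  chart_mem_atlas _ := Set.mem_range_self _

theorem ratio_affinePoint (i j k : Fin 2) (z : ℂ) :
    ratio i j (affinePoint k z) = (if i = k then 1 else z) / (if j = k then 1 else z) := rfl

theorem affinePoint_mem_affine (i k : Fin 2) (z : ℂ) :
    affinePoint k z ∈ affine i ↔ (if i = k then 1 else z) ≠ 0 :=
  mk_mem_affine i _ _

theorem contDiffOn_ratio_affinePoint (i j k : Fin 2) :
    ContDiffOn ℂ ω (fun z => ratio i j (affinePoint k z)) {z | affinePoint k z ∈ affine j} := by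
  intro z hz
  have hz' := (affinePoint_mem_affine j k z).1 hz
  change ContDiffWithinAt ℂ ω
    (fun z => (if i = k then (1 : ℂ) else z) / (if j = k then 1 else z)) _ _
  have key : ∀ l : Fin 2, ContDiff ℂ ω (fun z : ℂ => if l = k then (1 : ℂ) else z) := by
    intro l
    by_cases h : l = k
    · simpa only [h, if_true] using contDiff_const
    · simp only [h, if_false]
      exact contDiff_id
  exact (key i).contDiffWithinAt.div (key j).contDiffWithinAt hz'

instance : IsManifold 𝓘(ℂ, ℂ) ω P1 := by
  apply isManifold_of_contDiffOn
  rintro _ _ ⟨i, rfl⟩ ⟨j, rfl⟩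
  refine (contDiffOn_ratio_affinePoint j.rev j i).mono ?_
  intro z hz
  exact hz.1.2

theorem contMDiffOn_ratio (i j : Fin 2) :
    ContMDiffOn 𝓘(ℂ, ℂ) 𝓘(ℂ, ℂ) ω (ratio i j) (affine j) := by
  rw [contMDiffOn_iff]
  refine ⟨continuousOn_ratio i j, fun x _ => ?_⟩
  refine (contDiffOn_ratio_affinePoint i j (indexAt x)).mono ?_
  rintro z ⟨_, hz, _⟩
  exact hz

/-- The holomorphic line bundle `O(d)` over the projective line, the `d`-th power of the
hyperplane section bundle: it has the standard trivializations over `affine 0` and `affine 1`, and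
the transition function from the `i`-th to the `j`-th trivialization is `(v i / v j) ^ d`.
(A homogeneous polynomial `s` of degree `d` gives the section that is `s(v) / v i ^ d` in the
`i`-th trivialization.) -/
def bundleO (d : ℕ) : VectorBundleCore ℂ P1 ℂ (Fin 2) where
  baseSet := affine
  isOpen_baseSet := isOpen_affine
  indexAt := indexAt
  mem_baseSet_at := mem_affine_indexAt
  coordChange i j x := (ratio i j x ^ d) • ContinuousLinearMap.id ℂ ℂ
  coordChange_self i x hx v := by
    have : ratio i i x = 1 := hx
    simp [this]
  continuousOn_coordChange i j :=
    (((continuousOn_ratio i j).mono Set.inter_subset_right).pow d).smul continuousOn_const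
  coordChange_comp := by
    rintro i j k x ⟨⟨_, hj⟩, _⟩ v
    have : ratio j k x * ratio i j x = ratio i k x := by
      induction x using Projectivization.ind with
      | h w hw =>
        have hj' : w j ≠ 0 := (mk_mem_affine j w hw).1 hj
        simp only [ratio_mk]
        field_simp
    simp [← this, mul_pow, mul_assoc]

instance (d : ℕ) : (bundleO d).IsContMDiff 𝓘(ℂ, ℂ) ω where
  contMDiffOn_coordChange i j :=
    (((contMDiffOn_ratio i j).mono Set.inter_subset_right).pow d).smul contMDiffOn_const

/-- The line bundle `O(d) → ℙ¹`. -/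
abbrev O (d : ℕ) : P1 → Type := (bundleO d).Fiber

end FubiniStudy

end

noncomputable section

namespace FubiniStudy

/-! ### Derivatives of functions depending smoothly on a parameter -/

/-! If `e` is an orthonormal basis for an inner product on sections, Cauchy–Schwarz gives `κ = ∑ h(e
j, e j)` (`bergman_eq_sum`). In an affine chart this is the weight of `h` times `∑ |F j|²`, with `F
j` entire functions representing the sections. The weight cancels `ω`, so membership in `𝓗_ω` means
positivity of `i ∂∂̄ log ∑ |F j|²`. By strict Cauchy–Schwarz this holds wherever the vectors `(F j)`
and `(F j')` are linearly independent (`iddbarPlane_log_sum_norm_sq_pos`).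

That independence only needs the local functions `1` and `z` in each chart, that is, `s₀, s₁` in one
and `s_d, s_{d-1}` in the other. For `d ≥ 4` none of these is `s₂`, so `1, z, t z², z³, …` still
gives an element of `𝓗_ω` at `t = 0` (`separatesJets_of_mem_span`). The parameter enters only
through `t²` inside a logarithm of a positive function. The potentials are therefore jointly smooth
in `(t, z)`, and all derivatives converge uniformly on compact sets as `t → 0`.

The limit is not in the image. Averaging `∑ |F j|²` over circles shows that the coefficient of
`|z|⁴` is the sum of the squared moduli of the `z²`-coefficients of the `F j`
(`sum_norm_sq_coeff_eq`). For the limit potential it vanishes, so no element of the orthonormal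
basis would involve `z²`, although the basis must span `s₂`. Sections are polynomials of degree at
most `d` by a Liouville argument (`exists_polynomial_of_transition`). -/

theorem contDiff_fderiv_param {P E F : Type*} [NormedAddCommGroup P] [NormedSpace ℝ P]
    [NormedAddCommGroup E] [NormedSpace ℝ E] [NormedAddCommGroup F] [NormedSpace ℝ F]
    {f : P → E → F} (hf : ContDiff ℝ ∞ (fun q : P × E => f q.1 q.2)) :
    ContDiff ℝ ∞ (fun q : P × E => fderiv ℝ (f q.1) q.2) :=
  ContDiff.fderiv (m := ∞) (f := fun q : P × E => f q.1)
    (hf.comp ((contDiff_fst.comp contDiff_fst).prodMk contDiff_snd)) contDiff_snd (by simp)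

set_option synthInstance.maxHeartbeats 200000 in
theorem contDiff_iteratedFDeriv_param {P E F : Type*} [NormedAddCommGroup P] [NormedSpace ℝ P]
    [NormedAddCommGroup E] [NormedSpace ℝ E] [NormedAddCommGroup F] [NormedSpace ℝ F]
    {f : P → E → F} (hf : ContDiff ℝ ∞ (fun q : P × E => f q.1 q.2)) (n : ℕ) :
    ContDiff ℝ ∞ (fun q : P × E => iteratedFDeriv ℝ n (f q.1) q.2) := by
  induction n with
  | zero =>
    simp only [iteratedFDeriv_zero_eq_comp, Function.comp_def]
    exact (LinearIsometryEquiv.contDiff _).comp hf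
  | succ n ih =>
    simp only [iteratedFDeriv_succ_eq_comp_left, Function.comp_def]
    exact (LinearIsometryEquiv.contDiff _).comp
      (contDiff_fderiv_param (f := fun p => iteratedFDeriv ℝ n (f p)) ih)

/-- Currying turns joint continuity into continuity of a map from `P` to `C(E, F)` with the
compact-open topology, which is uniform convergence on compact sets. Applied to iterated
derivatives, it yields convergence in the Fréchet topology. -/
theorem tendstoUniformlyOn_of_continuous {P E F : Type*} [TopologicalSpace P]
    [TopologicalSpace E] [UniformSpace F] {f : P → E → F} (hf : Continuous fun q : P × E => f q.1 q.2)
    (p : P) {K : Set E} (hK : IsCompact K) : TendstoUniformlyOn f (f p) (𝓝 p) K := by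
  have h : Continuous fun q => (⟨f q, hf.comp (by fun_prop : Continuous fun x => (q, x))⟩ : C(E, F)) :=
    ContinuousMap.continuous_of_continuous_uncurry _ hf
  exact ContinuousMap.tendsto_iff_forall_isCompact_tendstoUniformlyOn.1 (h.tendsto p) K hK

/-! ### The form `i ∂∂̄` on the plane -/

theorem iddbarPlane_add {f g : ℂ → ℝ} (hf : ContDiff ℝ ∞ f) (hg : ContDiff ℝ ∞ g) (p v w : ℂ) :
    iddbarPlane (fun z => f z + g z) p v w = iddbarPlane f p v w + iddbarPlane g p v w := by
  have h1 : fderiv ℝ (fun z => f z + g z) = fun z => fderiv ℝ f z + fderiv ℝ g z := by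
    funext z
    exact fderiv_fun_add (hf.differentiable (by simp) z) (hg.differentiable (by simp) z)
  have h2 : fderiv ℝ (fun z => fderiv ℝ f z + fderiv ℝ g z) p
      = fderiv ℝ (fderiv ℝ f) p + fderiv ℝ (fderiv ℝ g) p :=
    fderiv_fun_add ((hf.fderiv_right (m := ∞) (by simp)).differentiable (by simp) p)
      ((hg.fderiv_right (m := ∞) (by simp)).differentiable (by simp) p)
  simp only [iddbarPlane, h1, h2, add_apply]
  ring

theorem hasDerivAt_comp_add_mul {G : Type*} [NormedAddCommGroup G] [NormedSpace ℝ G] {f : ℂ → G}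
    (hf : Differentiable ℝ f) (p v : ℂ) (t : ℝ) :
    HasDerivAt (fun r : ℝ => f (p + r * v)) (fderiv ℝ f (p + t * v) v) t := by
  have hl : HasDerivAt (fun r : ℝ => p + r * v) v t := by
    simpa using ((Complex.ofRealCLM.hasDerivAt (x := t)).mul_const v).const_add p
  exact (hf _).hasFDerivAt.comp_hasDerivAt t hl

/-- Reduces the Hessian on the diagonal to one-variable calculus along the real line through `p` in
the direction `v`. -/
theorem fderiv_fderiv_apply_eq_deriv {f : ℂ → ℝ} (hf : ContDiff ℝ ∞ f) (p v : ℂ) :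
    fderiv ℝ (fderiv ℝ f) p v v
      = deriv (fun t : ℝ => deriv (fun r : ℝ => f (p + r * v)) t) 0 := by
  have h1 : ∀ t : ℝ, deriv (fun r : ℝ => f (p + r * v)) t = fderiv ℝ f (p + t * v) v := fun t =>
    (hasDerivAt_comp_add_mul (hf.differentiable (by simp)) p v t).deriv
  have h2 : Differentiable ℝ (fun z => fderiv ℝ f z v) :=
    ((hf.fderiv_right (m := ∞) (by simp)).clm_apply contDiff_const).differentiable (by simp)
  have h3 : fderiv ℝ (fun z => fderiv ℝ f z v) p v = fderiv ℝ (fderiv ℝ f) p v v := by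
    rw [fderiv_clm_apply ((hf.fderiv_right (m := ∞) (by simp)).differentiable (by simp) p)
      (differentiableAt_const v)]
    simp
  simp only [h1]
  simpa [h3] using (hasDerivAt_comp_add_mul h2 p v 0).deriv.symm

/-! ### The Levi form of `log ∑ |F j|²` -/

section LogNormSq

variable {ι : Type*} [Fintype ι] {F : ι → ℂ → ℂ}

theorem contDiff_sum_norm_sq (hF : ∀ j, Differentiable ℂ (F j)) :
    ContDiff ℝ ∞ (fun z => ∑ j, ‖F j z‖ ^ 2) :=
  ContDiff.sum fun j _ => ((hF j).contDiff.restrict_scalars ℝ).norm_sq ℝ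

/-- With `N = ∑ |F j|²` restricted to the line `p + r v`, this is `(log N)'' = (N'' N - N'²) / N²`.
-/
theorem fderiv_fderiv_log_sum_norm_sq (hF : ∀ j, Differentiable ℂ (F j))
    (hpos : ∀ z, 0 < ∑ j, ‖F j z‖ ^ 2) (p v : ℂ) :
    fderiv ℝ (fderiv ℝ (fun z => Real.log (∑ j, ‖F j z‖ ^ 2))) p v v
      = ((∑ j, 2 * ((F j p * (starRingEnd ℂ) (deriv (deriv (F j)) p * v * v)).re
            + ‖deriv (F j) p * v‖ ^ 2)) * (∑ j, ‖F j p‖ ^ 2)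
        - (∑ j, 2 * (F j p * (starRingEnd ℂ) (deriv (F j) p * v)).re) ^ 2)
            / (∑ j, ‖F j p‖ ^ 2) ^ 2 := by
  rw [fderiv_fderiv_apply_eq_deriv ((contDiff_sum_norm_sq hF).log fun z => (hpos z).ne')]
  have hl : ∀ t : ℝ, HasDerivAt (fun r : ℝ => p + r * v) v t := fun t => by
    simpa using ((Complex.ofRealCLM.hasDerivAt (x := t)).mul_const v).const_add p
  have hc : ∀ {G : ℂ → ℂ}, Differentiable ℂ G → ∀ t : ℝ,
      HasDerivAt (fun r : ℝ => G (p + r * v)) (deriv G (p + t * v) * v) t := fun {G} hG t =>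
    (hG _).hasDerivAt.comp t (hl t)
  have hN : ∀ t : ℝ, HasDerivAt (fun r : ℝ => ∑ j, ‖F j (p + r * v)‖ ^ 2)
      (∑ j, 2 * inner ℝ (F j (p + t * v)) (deriv (F j) (p + t * v) * v)) t := fun t =>
    HasDerivAt.fun_sum fun j _ => (hc (hF j) t).norm_sq
  have hN' : HasDerivAt
      (fun t : ℝ => ∑ j, 2 * inner ℝ (F j (p + t * v)) (deriv (F j) (p + t * v) * v))
      (∑ j, 2 * (inner ℝ (F j (p + (0 : ℝ) * v)) (deriv (deriv (F j)) (p + (0 : ℝ) * v) * v * v)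
        + inner ℝ (deriv (F j) (p + (0 : ℝ) * v) * v) (deriv (F j) (p + (0 : ℝ) * v) * v))) 0 :=
    HasDerivAt.fun_sum fun j _ =>
      ((hc (hF j) 0).inner ℝ ((hc (hF j).deriv 0).mul_const v)).const_mul 2
  have hlog : ∀ t : ℝ, deriv (fun r : ℝ => Real.log (∑ j, ‖F j (p + r * v)‖ ^ 2)) t
      = (∑ j, 2 * inner ℝ (F j (p + t * v)) (deriv (F j) (p + t * v) * v))
        / ∑ j, ‖F j (p + t * v)‖ ^ 2 := fun t => ((hN t).log (hpos _).ne').deriv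
  simp only [hlog]
  refine (hN'.fun_div (hN 0) (hpos _).ne').deriv.trans ?_
  simp only [real_inner_self_eq_norm_sq, Complex.inner, Complex.ofReal_zero, zero_mul, add_zero]
  have hre : ∀ a b : ℂ, (a * (starRingEnd ℂ) b).re = (b * (starRingEnd ℂ) a).re := fun a b => by
    simp only [Complex.mul_re, Complex.conj_re, Complex.conj_im]; ring
  simp only [hre (F _ p)]
  ring

/-- The form at `(v, iv)` is half the sum of the Hessians of `v` and `iv`. The terms with `F j''`
cancel because `(iv)² = -v²`, and the squared real parts for `v` and `iv` add up to a squared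
modulus. What remains is the Cauchy–Schwarz defect of `(F j)` and `(F j')`. -/
theorem iddbarPlane_log_sum_norm_sq (hF : ∀ j, Differentiable ℂ (F j))
    (hpos : ∀ z, 0 < ∑ j, ‖F j z‖ ^ 2) (p v : ℂ) :
    iddbarPlane (fun z => Real.log (∑ j, ‖F j z‖ ^ 2)) p v (Complex.I * v)
      = 2 * ‖v‖ ^ 2 * ((∑ j, ‖F j p‖ ^ 2) * (∑ j, ‖deriv (F j) p‖ ^ 2)
        - ‖∑ j, F j p * (starRingEnd ℂ) (deriv (F j) p)‖ ^ 2) / (∑ j, ‖F j p‖ ^ 2) ^ 2 := by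
  have hI : Complex.I * (Complex.I * v) = -v := by
    rw [← mul_assoc, Complex.I_mul_I, neg_one_mul]
  rw [iddbarPlane, hI, map_neg, sub_neg_eq_add, fderiv_fderiv_log_sum_norm_sq hF hpos,
    fderiv_fderiv_log_sum_norm_sq hF hpos, ← add_div]
  have h1 : (∑ j, 2 * ((F j p * (starRingEnd ℂ)
        (deriv (deriv (F j)) p * (Complex.I * v) * (Complex.I * v))).re
          + ‖deriv (F j) p * (Complex.I * v)‖ ^ 2))
      + (∑ j, 2 * ((F j p * (starRingEnd ℂ) (deriv (deriv (F j)) p * v * v)).re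
          + ‖deriv (F j) p * v‖ ^ 2)) = 4 * ‖v‖ ^ 2 * ∑ j, ‖deriv (F j) p‖ ^ 2 := by
    rw [← Finset.sum_add_distrib, Finset.mul_sum]
    refine Finset.sum_congr rfl fun j _ => ?_
    have : deriv (deriv (F j)) p * (Complex.I * v) * (Complex.I * v)
        = -(deriv (deriv (F j)) p * v * v) := by
      linear_combination (deriv (deriv (F j)) p * v * v) * Complex.I_mul_I
    rw [this]
    simp only [norm_mul, Complex.norm_I, map_neg, mul_neg, Complex.neg_re]
    ring
  have h2 : (∑ j, 2 * (F j p * (starRingEnd ℂ) (deriv (F j) p * (Complex.I * v))).re) ^ 2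
      + (∑ j, 2 * (F j p * (starRingEnd ℂ) (deriv (F j) p * v)).re) ^ 2
      = 4 * ‖v‖ ^ 2 * ‖∑ j, F j p * (starRingEnd ℂ) (deriv (F j) p)‖ ^ 2 := by
    have h3 : ∀ w : ℂ, ∑ j, 2 * (F j p * (starRingEnd ℂ) (deriv (F j) p * w)).re
        = 2 * ((∑ j, F j p * (starRingEnd ℂ) (deriv (F j) p)) * (starRingEnd ℂ) w).re := by
      intro w
      rw [Finset.sum_mul, Complex.re_sum, Finset.mul_sum]
      simp only [map_mul, mul_assoc]
    rw [h3, h3]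
    generalize ∑ j, F j p * (starRingEnd ℂ) (deriv (F j) p) = S
    simp only [← Complex.normSq_eq_norm_sq, Complex.normSq_apply, map_mul, Complex.conj_I,
      Complex.mul_re, Complex.mul_im, Complex.conj_re, Complex.conj_im, Complex.I_re, Complex.I_im,
      Complex.neg_re, Complex.neg_im]
    ring
  rw [div_div, mul_comm _ (2 : ℝ), ← div_div]
  congr 1
  linear_combination (∑ j, ‖F j p‖ ^ 2) / 2 * h1 - h2 / 2

/-- Equality in Cauchy–Schwarz would make `a` a multiple of `b`, a nontrivial linear relation. -/
theorem norm_sum_mul_conj_sq_lt {a b : ι → ℂ}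
    (h : ∀ α β : ℂ, (∀ j, α * a j + β * b j = 0) → α = 0 ∧ β = 0) :
    ‖∑ j, a j * (starRingEnd ℂ) (b j)‖ ^ 2 < (∑ j, ‖a j‖ ^ 2) * (∑ j, ‖b j‖ ^ 2) := by
  set x : EuclideanSpace ℂ ι := WithLp.toLp 2 a
  set y : EuclideanSpace ℂ ι := WithLp.toLp 2 b
  have hi : inner ℂ y x = ∑ j, a j * (starRingEnd ℂ) (b j) := by
    simp [x, y, PiLp.inner_apply]
  have hx : ∑ j, ‖a j‖ ^ 2 = ‖x‖ ^ 2 := by simp [x, EuclideanSpace.norm_sq_eq]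
  have hy : ∑ j, ‖b j‖ ^ 2 = ‖y‖ ^ 2 := by simp [y, EuclideanSpace.norm_sq_eq]
  rw [← hi, hx, hy, ← mul_pow, mul_comm ‖x‖]
  refine pow_lt_pow_left₀ (lt_of_le_of_ne (norm_inner_le_norm y x) fun he => ?_)
    (norm_nonneg _) two_ne_zero
  have hx0 : x ≠ 0 := fun h0 => one_ne_zero (h 1 0 fun j => by
    have : x j = 0 := by rw [h0]; rfl
    simpa [x] using this).1
  have hy0 : y ≠ 0 := fun h0 => one_ne_zero (h 0 1 fun j => by
    have : y j = 0 := by rw [h0]; rfl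
    simpa [y] using this).2
  obtain ⟨r, hr, hxy⟩ := (norm_inner_eq_norm_iff hy0 hx0).1 he
  refine one_ne_zero (α := ℂ) (h 1 (-r) fun j => ?_).1
  have : x j = r * y j := by rw [hxy]; rfl
  simp only [x, y] at this
  rw [this]
  ring

/-- `i ∂∂̄ log ‖F‖²` is positive where the holomorphic curve `F` and its derivative are linearly
independent. -/
theorem iddbarPlane_log_sum_norm_sq_pos (hF : ∀ j, Differentiable ℂ (F j))
    (h : ∀ z α β : ℂ, (∀ j, α * F j z + β * deriv (F j) z = 0) → α = 0 ∧ β = 0)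
    (p : ℂ) {v : ℂ} (hv : v ≠ 0) :
    0 < iddbarPlane (fun z => Real.log (∑ j, ‖F j z‖ ^ 2)) p v (Complex.I * v) := by
  have hlt := fun z => norm_sum_mul_conj_sq_lt (h z)
  have hpos : ∀ z, 0 < ∑ j, ‖F j z‖ ^ 2 := fun z => by
    have h1 := (sq_nonneg _).trans_lt (hlt z)
    exact (pos_iff_pos_of_mul_pos h1).2 (pos_of_mul_pos_right h1 (by positivity))
  rw [iddbarPlane_log_sum_norm_sq hF hpos]
  have := sub_pos.2 (hlt p)
  have := hpos p
  positivity

end LogNormSq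

/-! ### Entire functions of polynomial growth -/

/-- A pair of entire functions that glue to a section of `O(d)` is given by a polynomial of
degree at most `d`. -/
theorem exists_polynomial_of_transition (d : ℕ) {f g : ℂ → ℂ} (hf : Differentiable ℂ f)
    (hg : Differentiable ℂ g) (h : ∀ z, z ≠ 0 → f z = z ^ d * g z⁻¹) :
    ∃ p : Polynomial ℂ, p.natDegree ≤ d ∧ ∀ z, f z = p.eval z := by
  induction d generalizing f g with
  | zero =>
    -- The values of `f` outside the unit disc are values of `g` inside it, so `f` is bounded and
    -- Liouville's theorem applies.
    have hb : Bornology.IsBounded (Set.range f) := by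
      have hK := isCompact_closedBall (0 : ℂ) 1
      refine ((hK.image hf.continuous).isBounded.union
        (hK.image hg.continuous).isBounded).subset ?_
      rintro _ ⟨z, rfl⟩
      rcases le_total ‖z‖ 1 with hz | hz
      · exact Or.inl ⟨z, by simpa using hz, rfl⟩
      · have hz0 : z ≠ 0 := norm_pos_iff.1 (by linarith)
        refine Or.inr ⟨z⁻¹, ?_, by simp [h z hz0]⟩
        simpa using inv_le_one_of_one_le₀ hz
    exact ⟨Polynomial.C (f 0), by simp, fun z => by
      simpa using hf.apply_eq_apply_of_bounded hb z 0⟩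
  | succ d ih =>
    have hf1 : Differentiable ℂ (dslope f 0) := by
      rw [← differentiableOn_univ] at hf ⊢
      exact (Complex.differentiableOn_dslope Filter.univ_mem).2 hf
    have hslope : ∀ z, f z = f 0 + z * dslope f 0 z := fun z => by
      have := sub_smul_dslope f 0 z
      rw [sub_zero, smul_eq_mul] at this
      rw [this]; ring
    -- Writing `f z = f 0 + z q(z)`, the transition rule becomes `q(z) = z ^ d (g(1/z) - f 0 (1/z) ^
    -- (d + 1))`, which dictates the new `g`.
    obtain ⟨p, hp, hpf⟩ := ih (f := dslope f 0) (g := fun w => g w - f 0 * w ^ (d + 1)) hf1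
      (hg.sub ((differentiable_id.pow _).const_mul _)) fun z hz => by
        have h1 := hslope z
        rw [h z hz] at h1
        refine mul_left_cancel₀ hz ?_
        have h2 : z ^ (d + 1) * (z⁻¹) ^ (d + 1) = 1 := by
          rw [← mul_pow, mul_inv_cancel₀ hz, one_pow]
        linear_combination -h1 + f 0 * h2
    refine ⟨Polynomial.C (f 0) + Polynomial.X * p, ?_, fun z => ?_⟩
    · refine (Polynomial.natDegree_add_le _ _).trans (max_le (by simp) ?_)
      exact (Polynomial.natDegree_mul_le).trans (by rw [Polynomial.natDegree_X]; omega)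
    · rw [hslope z, hpf z]; simp

/-! ### Parseval's identity on circles around the origin -/

/-- The radius is absorbed into the coefficients `a k * r ^ k`, reducing to Parseval for a
polynomial on the unit circle. -/
theorem circleAverage_norm_sq_sum_mul_pow (n : ℕ) (a : ℕ → ℂ) (r : ℝ) :
    Real.circleAverage (fun θ => ‖∑ k ∈ Finset.range n, a k * (r * θ) ^ k‖ ^ 2) 0 1
      = ∑ k ∈ Finset.range n, ‖a k‖ ^ 2 * (r ^ 2) ^ k := by
  set p : Polynomial ℂ := ∑ k ∈ Finset.range n, Polynomial.monomial k (a k * (r : ℂ) ^ k) with hp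
  have hc : ∀ k, p.coeff k = if k < n then a k * (r : ℂ) ^ k else 0 := fun k => by
    simp [hp, Polynomial.finsetSum_coeff, Polynomial.coeff_monomial]
  have he : ∀ θ, p.eval θ = ∑ k ∈ Finset.range n, a k * (r * θ) ^ k := fun θ => by
    simp [hp, Polynomial.eval_finsetSum, Polynomial.eval_monomial, mul_pow, mul_assoc]
  have hs : p.support ⊆ Finset.range n := fun k hk => by
    by_contra hkn
    rw [Polynomial.mem_support_iff, hc, if_neg (by simpa using hkn)] at hk
    exact hk rfl
  simp only [← he, ← Polynomial.sum_sq_norm_coeff_eq_circleAverage]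
  rw [Finset.sum_subset hs fun k _ hk => by simp [Polynomial.notMem_support_iff.1 hk]]
  refine Finset.sum_congr rfl fun k hk => ?_
  rw [hc, if_pos (Finset.mem_range.1 hk), norm_mul, norm_pow, mul_pow, Complex.norm_real,
    ← pow_mul, ← pow_mul, mul_comm k, pow_mul, pow_mul, Real.norm_eq_abs, sq_abs]

/-- The diagonal coefficients of a sum of squared absolute values of polynomials are determined
by its values. -/
theorem sum_norm_sq_coeff_eq {ι : Type*} [Fintype ι] (n : ℕ) (a : ι → ℕ → ℂ) (c : ℕ → ℝ)
    (h : ∀ z : ℂ, ∑ j, ‖∑ k ∈ Finset.range n, a j k * z ^ k‖ ^ 2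
      = ∑ k ∈ Finset.range n, c k * (‖z‖ ^ 2) ^ k) {k : ℕ} (hk : k < n) :
    ∑ j, ‖a j k‖ ^ 2 = c k := by
  have h1 : ∀ r : ℝ, ∑ k ∈ Finset.range n, (∑ j, ‖a j k‖ ^ 2) * (r ^ 2) ^ k
      = ∑ k ∈ Finset.range n, c k * (r ^ 2) ^ k := fun r => by
    -- The right-hand side of `h` is radial, so averaging leaves it unchanged; on the left it kills
    -- the cross terms.
    have hav : Real.circleAverage
        (fun θ : ℂ => ∑ j, ‖∑ k ∈ Finset.range n, a j k * (r * θ) ^ k‖ ^ 2) 0 1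
        = ∑ k ∈ Finset.range n, c k * (r ^ 2) ^ k := by
      refine Real.circleAverage_const_on_circle fun θ hθ => ?_
      have hn : ‖θ‖ = 1 := by simpa using hθ
      rw [h, norm_mul, hn, mul_one, Complex.norm_real, Real.norm_eq_abs, sq_abs]
    rw [← hav, Real.circleAverage_fun_sum fun j _ =>
      (Continuous.continuousOn (by fun_prop)).circleIntegrable zero_le_one]
    simp only [circleAverage_norm_sq_sum_mul_pow, Finset.sum_mul]
    exact Finset.sum_comm
  set p : Polynomial ℝ := ∑ k ∈ Finset.range n, Polynomial.monomial k (∑ j, ‖a j k‖ ^ 2) with hp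
  set q : Polynomial ℝ := ∑ k ∈ Finset.range n, Polynomial.monomial k (c k) with hq
  have hpq : p = q := by
    -- Both sides are polynomials in `x = r²` and agree for every `x ≥ 0`.
    refine Polynomial.eq_of_infinite_eval_eq p q ((Set.Ici_infinite (0 : ℝ)).mono fun x hx => ?_)
    have := h1 (Real.sqrt x)
    rw [Real.sq_sqrt hx] at this
    simpa [hp, hq, Polynomial.eval_finsetSum, Polynomial.eval_monomial, Finset.sum_mul] using this
  have := congrArg (Polynomial.coeff · k) hpq
  simpa [hp, hq, Polynomial.finsetSum_coeff, Polynomial.coeff_monomial, hk] using this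

/-! ### Inner products and orthonormal bases -/

section Core

variable {V : Type*} [AddCommGroup V] [Module ℂ V] {ι : Type*} [Fintype ι]

theorem core_inner_eq_of_orthonormal [DecidableEq ι] (c : InnerProductSpace.Core ℂ V)
    (e : Module.Basis ι ℂ V) (he : ∀ j k, c.inner (e j) (e k) = if j = k then 1 else 0) (s : V) :
    (c.inner s s).re = ∑ j, ‖e.repr s j‖ ^ 2 := by
  let := c.toNormedAddCommGroup
  let : InnerProductSpace ℂ V := InnerProductSpace.ofCore c.toCore
  have ho : Orthonormal ℂ e := orthonormal_iff_ite.2 he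
  have h1 := (e.toOrthonormalBasis ho).sum_sq_norm_inner_right s
  have h2 : (c.inner s s).re = ‖s‖ ^ 2 := inner_self_eq_norm_sq (𝕜 := ℂ) s
  rw [h2, ← h1]
  refine Finset.sum_congr rfl fun j _ => ?_
  rw [← OrthonormalBasis.repr_apply_apply]
  simp

theorem exists_orthonormal_basis_core [FiniteDimensional ℂ V] (c : InnerProductSpace.Core ℂ V) :
    ∃ e : Module.Basis (Fin (Module.finrank ℂ V)) ℂ V,
      ∀ j k, c.inner (e j) (e k) = if j = k then 1 else 0 := by
  let := c.toNormedAddCommGroup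
  let : InnerProductSpace ℂ V := InnerProductSpace.ofCore c.toCore
  refine ⟨(stdOrthonormalBasis ℂ V).toBasis, fun j k => ?_⟩
  have := orthonormal_iff_ite.1 (stdOrthonormalBasis ℂ V).orthonormal j k
  rwa [OrthonormalBasis.coe_toBasis]

/-- The inner product for which a given basis is orthonormal. -/
@[reducible] def coreOfBasis (e : Module.Basis ι ℂ V) : InnerProductSpace.Core ℂ V where
  inner x y := ∑ j, (starRingEnd ℂ) (e.repr x j) * e.repr y j
  conj_inner_symm x y := by simp [mul_comm]
  re_inner_nonneg x := by
    rw [map_sum]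
    refine Finset.sum_nonneg fun j _ => ?_
    rw [← Complex.normSq_eq_conj_mul_self]
    exact Complex.normSq_nonneg _
  add_left x y z := by simp [add_mul, Finset.sum_add_distrib]
  smul_left x y r := by simp [Finset.mul_sum, mul_assoc]
  definite x hx := by
    have h : ∑ j, Complex.normSq (e.repr x j) = 0 := by
      simpa only [← Complex.normSq_eq_conj_mul_self, ← Complex.ofReal_sum,
        Complex.ofReal_eq_zero] using hx
    refine e.ext_elem fun j => ?_
    rw [Finset.sum_eq_zero_iff_of_nonneg fun j _ => Complex.normSq_nonneg _] at h
    simpa using h j (Finset.mem_univ j)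

theorem coreOfBasis_inner [DecidableEq ι] (e : Module.Basis ι ℂ V) (j k : ι) :
    (coreOfBasis e).inner (e j) (e k) = if j = k then 1 else 0 := by
  change ∑ l, (starRingEnd ℂ) (e.repr (e j) l) * e.repr (e k) l = _
  simp [Finsupp.single_apply]

end Core

/-! ### Smooth functions on the projective line -/

instance : IsManifold 𝓘(ℝ, ℂ) ∞ P1 := by
  apply isManifold_of_contDiffOn
  rintro _ _ ⟨i, rfl⟩ ⟨j, rfl⟩
  refine (((contDiffOn_ratio_affinePoint j.rev j i).restrict_scalars ℝ).of_le (by simp)).mono ?_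
  intro z hz
  exact hz.1.2

/-- The center of each chart lies in that chart only. Hence each of the two trivializations is the
preferred one somewhere, and the smoothness condition on a hermitian metric reaches both. -/
theorem indexAt_affinePoint_zero (i : Fin 2) : indexAt (affinePoint i 0) = i := by
  unfold indexAt
  fin_cases i <;> simp [affinePoint_mem_affine]

theorem affinePoint_mem (i : Fin 2) (z : ℂ) : affinePoint i z ∈ affine i :=
  (chart i).map_target (Set.mem_univ z)

theorem affinePoint_ratio {i : Fin 2} {x : P1} (hx : x ∈ affine i) :
    affinePoint i (ratio i.rev i x) = x :=
  (chart i).left_inv hx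

theorem exists_affinePoint (x : P1) : ∃ i z, affinePoint i z = x :=
  ⟨_, _, affinePoint_ratio (mem_affine_indexAt x)⟩

theorem contMDiff_affinePoint_real (i : Fin 2) :
    ContMDiff 𝓘(ℝ, ℂ) 𝓘(ℝ, ℂ) ∞ (affinePoint i) :=
  contMDiffOn_univ.1 (contMDiffOn_symm_of_mem_maximalAtlas (I := 𝓘(ℝ, ℂ)) (n := ∞)
    (IsManifold.subset_maximalAtlas (Set.mem_range_self i : chart i ∈ atlas ℂ P1)))

theorem contMDiff_affinePoint (i : Fin 2) :
    ContMDiff 𝓘(ℂ, ℂ) 𝓘(ℂ, ℂ) ω (affinePoint i) :=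
  contMDiffOn_univ.1 (contMDiffOn_symm_of_mem_maximalAtlas (I := 𝓘(ℂ, ℂ)) (n := ω)
    (IsManifold.subset_maximalAtlas (Set.mem_range_self i : chart i ∈ atlas ℂ P1)))

theorem contMDiff_of_affine {f : P1 → ℝ}
    (hf : ∀ i, ContDiff ℝ ∞ fun z => f (affinePoint i z)) : ContMDiff 𝓘(ℝ, ℂ) 𝓘(ℝ, ℝ) ∞ f := by
  intro x
  have hs := mem_affine_indexAt x
  have hc := contMDiffOn_of_mem_maximalAtlas (I := 𝓘(ℝ, ℂ)) (n := ∞)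
    (IsManifold.subset_maximalAtlas (Set.mem_range_self (indexAt x) : chart _ ∈ atlas ℂ P1))
  have h1 := ((hf (indexAt x)).contMDiff.contMDiffAt.comp x
    (hc.contMDiffAt ((isOpen_affine _).mem_nhds hs)))
  refine h1.congr_of_eventuallyEq ?_
  filter_upwards [(isOpen_affine _).mem_nhds hs] with y hy
  exact congrArg f (affinePoint_ratio hy).symm

/-! ### Local coordinates of sections and hermitian metrics on `O(d)` -/

variable {d : ℕ}

/-- The coordinate, in the `i`-th trivialization of `O(d)`, of a vector over the point with `i`-th
affine coordinate `z`. -/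
def fiberCoord (i : Fin 2) (z : ℂ) (v : O d (affinePoint i z)) : ℂ :=
  ((bundleO d).localTriv i ⟨affinePoint i z, v⟩).2

/-- The holomorphic function representing a section of `O(d)` in the `i`-th trivialization. -/
def localRep (i : Fin 2) (s : HolSection (O d)) (z : ℂ) : ℂ := fiberCoord i z (s (affinePoint i z))

/-- The vector over the point with `i`-th affine coordinate `z` whose coordinate is `1`. -/
def unitVector (d : ℕ) (i : Fin 2) (z : ℂ) : O d (affinePoint i z) :=
  ((bundleO d).localTriv i).symm (affinePoint i z) 1

theorem eq_fiberCoord_smul_unitVector (i : Fin 2) (z : ℂ) (v : O d (affinePoint i z)) :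
    v = fiberCoord i z v • unitVector d i z := by
  have hx : affinePoint i z ∈ ((bundleO d).localTriv i).baseSet := affinePoint_mem i z
  have h1 := ((bundleO d).localTriv i).symm_apply_apply_mk hx v
  have h2 := ((bundleO d).localTriv i).symmₗ_apply (R := ℂ) hx
  conv_lhs => rw [← h1]
  rw [unitVector, ← h2, ← h2, ← map_smul, smul_eq_mul, mul_one]
  rfl

theorem fiberCoord_unitVector (i : Fin 2) (z : ℂ) : fiberCoord i z (unitVector d i z) = 1 :=
  congrArg Prod.snd (((bundleO d).localTriv i).apply_mk_symm (affinePoint_mem i z) 1)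

theorem fiberCoord_linear (i : Fin 2) (z : ℂ) :
    IsLinearMap ℂ (fiberCoord (d := d) i z) :=
  ((bundleO d).localTriv i).linear ℂ (affinePoint_mem i z)

/-- `localRep` at a point, as a linear functional. -/
def evalLinear (d : ℕ) (i : Fin 2) (z : ℂ) : HolSection (O d) →ₗ[ℂ] ℂ where
  toFun s := localRep i s z
  map_add' _ _ := (fiberCoord_linear i z).map_add _ _
  map_smul' _ _ := (fiberCoord_linear i z).map_smul _ _

theorem evalLinear_apply (i : Fin 2) (z : ℂ) (s : HolSection (O d)) :
    evalLinear d i z s = localRep i s z := rfl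

instance (i : Fin 2) : MemTrivializationAtlas ((bundleO d).localTriv i) := ⟨⟨i, rfl⟩⟩

theorem differentiable_localRep (i : Fin 2) (s : HolSection (O d)) :
    Differentiable ℂ (localRep i s) := by
  have h1 := (((bundleO d).localTriv i).contMDiffOn_section_baseSet_iff (IB := 𝓘(ℂ, ℂ))
    (n := ω)).1 (s.contMDiff.contMDiffOn (s := ((bundleO d).localTriv i).baseSet))
  have h2 : ContMDiff 𝓘(ℂ, ℂ) 𝓘(ℂ, ℂ) ω (localRep i s) :=
    h1.comp_contMDiff (contMDiff_affinePoint i) fun z => affinePoint_mem i z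
  exact h2.contDiff.differentiable (by simp)

theorem affinePoint_zero_inv {z : ℂ} (hz : z ≠ 0) : affinePoint 0 z⁻¹ = affinePoint 1 z := by
  refine (Projectivization.mk_eq_mk_iff' ℂ _ _ _ _).2 ⟨z⁻¹, ?_⟩
  funext k
  fin_cases k <;> simp [hz]

/-- A vector of the fiber over `x` is stored by its coordinate in the trivialization `indexAt x`;
the claim is the cocycle identity for `indexAt x`, `0`, `1`. -/
theorem localTriv_transition (x : P1) (hx : ∀ i, x ∈ affine i) (v : O d x) :
    ((bundleO d).localTriv 1 ⟨x, v⟩).2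
      = ratio 0 1 x ^ d * ((bundleO d).localTriv 0 ⟨x, v⟩).2 := by
  have h := (bundleO d).coordChange_comp (indexAt x) 0 1 x ⟨⟨mem_affine_indexAt x, hx 0⟩, hx 1⟩ v
  exact h.symm

theorem localRep_one_eq {z : ℂ} (hz : z ≠ 0) (s : HolSection (O d)) :
    localRep 1 s z = z ^ d * localRep 0 s z⁻¹ := by
  have h0 : ∀ y, y = affinePoint 1 z →
      ((bundleO d).localTriv 0 ⟨y, s y⟩).2 =
      ((bundleO d).localTriv 0 ⟨affinePoint 1 z, s (affinePoint 1 z)⟩).2 := by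
    rintro _ rfl; rfl
  have h1 : localRep 0 s z⁻¹
      = ((bundleO d).localTriv 0 ⟨affinePoint 1 z, s (affinePoint 1 z)⟩).2 :=
    h0 _ (affinePoint_zero_inv hz)
  rw [h1, localRep, fiberCoord, localTriv_transition]
  · rw [ratio_affinePoint]; simp
  · intro i
    rw [affinePoint_mem_affine]
    split_ifs <;> simp [hz]

theorem HolSection.ext_localRep {s t : HolSection (O d)}
    (h : ∀ i z, localRep i s z = localRep i t z) : s = t := by
  ext x
  obtain ⟨i, z, rfl⟩ := exists_affinePoint x
  rw [eq_fiberCoord_smul_unitVector i z (s _), eq_fiberCoord_smul_unitVector i z (t _)]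
  exact congrArg (· • unitVector d i z) (h i z)

/-- Only the point at infinity is missing from chart `1`; it is recovered by continuity in chart
`0`. -/
theorem HolSection.ext_localRep_one {s t : HolSection (O d)}
    (h : ∀ z, localRep 1 s z = localRep 1 t z) : s = t := by
  refine HolSection.ext_localRep fun i => ?_
  fin_cases i
  · refine congrFun (Continuous.ext_on (dense_compl_singleton (0 : ℂ))
      (differentiable_localRep 0 s).continuous (differentiable_localRep 0 t).continuous ?_)
    intro w hw
    have hw' : w⁻¹ ≠ 0 := inv_ne_zero hw
    have h1 := h w⁻¹
    rw [localRep_one_eq hw', localRep_one_eq hw', inv_inv] at h1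
    exact mul_left_cancel₀ (pow_ne_zero d hw') h1
  · exact h

/-! ### The monomial sections -/

/-- The section of `O(d)` given by the homogeneous polynomial `v 0 ^ j * v 1 ^ (d - j)`. -/
def monomialSection (d : ℕ) (j : Fin (d + 1)) : HolSection (O d) where
  toFun x := (ratio 0 (indexAt x) x ^ (j : ℕ) * ratio 1 (indexAt x) x ^ (d - (j : ℕ)) : ℂ)
  contMDiff_toFun := by
    intro x₀
    refine (Bundle.contMDiffAt_section x₀).2 ?_
    have hx := mem_affine_indexAt x₀
    have hn := (isOpen_affine (indexAt x₀)).mem_nhds hx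
    refine ContMDiffAt.congr_of_eventuallyEq (f := fun x =>
      ratio 0 (indexAt x₀) x ^ (j : ℕ) * ratio 1 (indexAt x₀) x ^ (d - (j : ℕ))) ?_ ?_
    · exact (((contMDiffOn_ratio 0 _).contMDiffAt hn).pow _).mul
        (((contMDiffOn_ratio 1 _).contMDiffAt hn).pow _)
    -- The transition factor of degree `d = j + (d - j)` exchanges the denominators of the two
    -- ratios.
    · filter_upwards [hn] with x hx
      change ratio (indexAt x) (indexAt x₀) x ^ d *
        (ratio 0 (indexAt x) x ^ (j : ℕ) * ratio 1 (indexAt x) x ^ (d - (j : ℕ))) = _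
      have hx' := mem_affine_indexAt x
      induction x using Projectivization.ind with
      | h v hv =>
        generalize indexAt x₀ = k at *
        generalize indexAt (Projectivization.mk ℂ v hv) = l at *
        rw [mk_mem_affine] at hx hx'
        simp only [ratio_mk, div_pow]
        have hd : v l ^ d = v l ^ (j : ℕ) * v l ^ (d - (j : ℕ)) := by
          rw [← pow_add]; congr 1; omega
        have hd' : v k ^ d = v k ^ (j : ℕ) * v k ^ (d - (j : ℕ)) := by
          rw [← pow_add]; congr 1; omega
        rw [hd, hd']
        field_simp

theorem localRep_monomialSection (i : Fin 2) (j : Fin (d + 1)) (z : ℂ) :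
    localRep i (monomialSection d j) z = if i = 1 then z ^ (j : ℕ) else z ^ (d - (j : ℕ)) := by
  change ratio (indexAt (affinePoint i z)) i (affinePoint i z) ^ d *
    (ratio 0 (indexAt (affinePoint i z)) (affinePoint i z) ^ (j : ℕ)
      * ratio 1 (indexAt (affinePoint i z)) (affinePoint i z) ^ (d - (j : ℕ))) = _
  have hx' := mem_affine_indexAt (affinePoint i z)
  generalize indexAt (affinePoint i z) = l at *
  have hj : (j : ℕ) ≤ d := by omega
  rw [affinePoint_mem_affine] at hx'
  simp only [ratio_affinePoint]
  have hp : z ^ d = z ^ (j : ℕ) * z ^ (d - (j : ℕ)) := by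
    rw [← pow_add]; congr 1; omega
  fin_cases i <;> fin_cases l <;> simp at hx' ⊢ <;> rw [hp] <;> field_simp <;> simp

theorem linearIndependent_monomialSection (d : ℕ) :
    LinearIndependent ℂ (monomialSection d) := by
  rw [Fintype.linearIndependent_iff]
  intro g hg
  set p : Polynomial ℂ := ∑ j : Fin (d + 1), Polynomial.monomial (j : ℕ) (g j) with hp
  have hp0 : p = 0 := Polynomial.funext fun z => by
    have := congrArg (evalLinear d 1 z) hg
    rw [map_zero] at this
    simpa [evalLinear_apply, localRep_monomialSection, hp, Polynomial.eval_finsetSum] using this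
  intro j
  have := congrArg (Polynomial.coeff · (j : ℕ)) hp0
  simpa [hp, Polynomial.finsetSum_coeff, Polynomial.coeff_monomial, Fin.val_inj] using this

theorem span_monomialSection (d : ℕ) : ⊤ ≤ Submodule.span ℂ (Set.range (monomialSection d)) := by
  intro s _
  obtain ⟨p, hp, hps⟩ := exists_polynomial_of_transition d (differentiable_localRep 1 s)
    (differentiable_localRep 0 s) fun z hz => localRep_one_eq hz s
  have : s = ∑ j : Fin (d + 1), p.coeff j • monomialSection d j := by
    refine HolSection.ext_localRep_one fun z => ?_
    rw [hps, ← evalLinear_apply, map_sum, Polynomial.eval_eq_sum_range' (by omega : _ < d + 1),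
      Finset.sum_range]
    simp [evalLinear_apply, localRep_monomialSection]
  rw [this]
  exact Submodule.sum_mem _ fun j _ => Submodule.smul_mem _ _ (Submodule.subset_span ⟨j, rfl⟩)

/-- The basis `1, z, …, z ^ d` of the space of holomorphic sections of `O(d)`. -/
def monomialBasis (d : ℕ) : Module.Basis (Fin (d + 1)) ℂ (HolSection (O d)) :=
  Module.Basis.mk (linearIndependent_monomialSection d) (span_monomialSection d)

theorem monomialBasis_apply (j : Fin (d + 1)) : monomialBasis d j = monomialSection d j :=
  Module.Basis.mk_apply _ _ j

instance : FiniteDimensional ℂ (HolSection (O d)) := (monomialBasis d).finiteDimensional_of_finite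

/-! ### Potentials attached to families of sections -/

/-- The squared length of the local frame of `O(d)` in the `i`-th trivialization. -/
def HermitianMetric.weight (h : HermitianMetric (O d)) (i : Fin 2) (z : ℂ) : ℝ :=
  h.normSq (unitVector d i z)

theorem HermitianMetric.normSq_eq (h : HermitianMetric (O d)) (i : Fin 2) (z : ℂ)
    (v : O d (affinePoint i z)) : h.normSq v = h.weight i z * ‖fiberCoord i z v‖ ^ 2 := by
  conv_lhs => rw [eq_fiberCoord_smul_unitVector i z v]
  generalize fiberCoord i z v = c
  have hs := (h.inner (affinePoint i z)).conj_inner_symm (unitVector d i z)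
    (c • unitVector d i z)
  rw [(h.inner (affinePoint i z)).smul_left, map_mul, Complex.conj_conj,
    (h.inner (affinePoint i z)).conj_inner_symm] at hs
  rw [HermitianMetric.normSq, (h.inner (affinePoint i z)).smul_left, ← hs, ← mul_assoc,
    ← Complex.normSq_eq_conj_mul_self, Complex.re_ofReal_mul, Complex.normSq_eq_norm_sq, mul_comm]
  rfl

theorem HermitianMetric.weight_pos (h : HermitianMetric (O d)) (i : Fin 2) (z : ℂ) :
    0 < h.weight i z := by
  set c := h.inner (affinePoint i z)
  refine lt_of_le_of_ne (c.re_inner_nonneg _) fun h0 => ?_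
  have him : (c.inner (unitVector d i z) (unitVector d i z)).im = 0 :=
    Complex.conj_eq_iff_im.1 (c.conj_inner_symm _ _)
  have hu : unitVector d i z = 0 := c.definite _ (Complex.ext h0.symm him)
  have h1 := fiberCoord_unitVector (d := d) i z
  rw [hu, (fiberCoord_linear i z).map_zero] at h1
  exact zero_ne_one h1

theorem HermitianMetric.contDiff_weight (h : HermitianMetric (O d)) (i : Fin 2) :
    ContDiff ℝ ∞ (h.weight i) := by
  obtain ⟨x₀, rfl⟩ : ∃ x₀, indexAt x₀ = i := ⟨_, indexAt_affinePoint_zero i⟩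
  exact ((h.smooth x₀).comp_contMDiff (contMDiff_affinePoint_real _)
    fun z => affinePoint_mem _ z).contDiff

theorem HermitianMetric.normSq_section (h : HermitianMetric (O d)) (i : Fin 2) (z : ℂ)
    (s : HolSection (O d)) :
    h.normSq (s (affinePoint i z)) = h.weight i z * ‖localRep i s z‖ ^ 2 :=
  h.normSq_eq i z _

/-- The derivative of `localRep` at a point, as a linear functional. -/
def derivLinear (d : ℕ) (i : Fin 2) (z : ℂ) : HolSection (O d) →ₗ[ℂ] ℂ where
  toFun s := deriv (localRep i s) z
  map_add' s t := by
    have : localRep i (s + t) = fun z => localRep i s z + localRep i t z :=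
      funext fun z => (evalLinear d i z).map_add s t
    rw [this]
    exact deriv_fun_add (differentiable_localRep i s z) (differentiable_localRep i t z)
  map_smul' c s := by
    have : localRep i (c • s) = fun z => c * localRep i s z :=
      funext fun z => (evalLinear d i z).map_smul c s
    rw [this]
    exact deriv_const_mul c (differentiable_localRep i s z)

/-- A family of sections separates jets if the values and the derivatives of its local
representatives are linearly independent at every point. -/
def SeparatesJets {ι : Type*} (e : ι → HolSection (O d)) : Prop :=
  ∀ (i : Fin 2) (z α β : ℂ),
    (∀ j, α * localRep i (e j) z + β * deriv (localRep i (e j)) z = 0) → α = 0 ∧ β = 0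

/-- A relation between values and derivatives passes to the span. Testing it on the functions `1`
and `z` gives `α = 0` and `α z + β = 0`. These functions represent `s₀, s₁` in chart `1` and `s_d,
s_{d-1}` in chart `0`; `d ≥ 4` guarantees `d - 1 ≠ 2` and `d ≠ 2`. -/
theorem separatesJets_of_mem_span (hd : 4 ≤ d) {ι : Type*} {e : ι → HolSection (O d)}
    (he : ∀ j : Fin (d + 1), (j : ℕ) ≠ 2 → monomialSection d j ∈ Submodule.span ℂ (Set.range e)) :
    SeparatesJets e := by
  intro i z α β h
  set L : HolSection (O d) →ₗ[ℂ] ℂ := α • evalLinear d i z + β • derivLinear d i z with hL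
  have hker : Submodule.span ℂ (Set.range e) ≤ LinearMap.ker L := by
    rw [Submodule.span_le]
    rintro _ ⟨j, rfl⟩
    exact h j
  have key : ∀ (j : Fin (d + 1)) (k : ℕ), (j : ℕ) ≠ 2 →
      (if i = 1 then (j : ℕ) else d - (j : ℕ)) = k → α * z ^ k + β * (k * z ^ (k - 1)) = 0 := by
    intro j k hj hk
    have h1 : localRep i (monomialSection d j) = fun z => z ^ k := funext fun z => by
      rw [localRep_monomialSection, ← hk]; split_ifs <;> rfl
    have h2 : α * localRep i (monomialSection d j) z
        + β * deriv (localRep i (monomialSection d j)) z = 0 := hker (he j hj)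
    simpa [h1] using h2
  have h01 : α = 0 ∧ α * z + β = 0 := by
    by_cases hi : i = 1
    · constructor
      · simpa using key ⟨0, by omega⟩ 0 (by simp) (by simp [hi])
      · simpa using key ⟨1, by omega⟩ 1 (by simp) (by simp [hi])
    · constructor
      · simpa using key ⟨d, by omega⟩ 0 (by simp; omega) (by simp [hi])
      · simpa using key ⟨d - 1, by omega⟩ 1 (by simp; omega) (by simp [hi]; omega)
  obtain ⟨h0, h1⟩ := h01
  exact ⟨h0, by simpa [h0] using h1⟩

section LogPotential

variable {ι : Type*} [Fintype ι]

/-- The function `log ∑ h(e j, e j)` of a finite family of sections. -/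
def logPotential (h : HermitianMetric (O d)) (e : ι → HolSection (O d)) (x : P1) : ℝ :=
  Real.log (∑ j, h.normSq (e j x))

theorem SeparatesJets.sum_norm_sq_pos {e : ι → HolSection (O d)} (he : SeparatesJets e)
    (i : Fin 2) (z : ℂ) : 0 < ∑ j, ‖localRep i (e j) z‖ ^ 2 := by
  refine lt_of_le_of_ne (by positivity) fun h0 => ?_
  rw [eq_comm, Finset.sum_eq_zero_iff_of_nonneg fun j _ => by positivity] at h0
  refine one_ne_zero (α := ℂ) (he i z 1 0 fun j => ?_).1
  have := h0 j (Finset.mem_univ j)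
  simpa using this

theorem sum_normSq_affinePoint (h : HermitianMetric (O d)) (e : ι → HolSection (O d))
    (i : Fin 2) (z : ℂ) : ∑ j, h.normSq (e j (affinePoint i z))
      = h.weight i z * ∑ j, ‖localRep i (e j) z‖ ^ 2 := by
  simp only [h.normSq_section, Finset.mul_sum]

theorem logPotential_affinePoint (h : HermitianMetric (O d)) {e : ι → HolSection (O d)}
    (he : SeparatesJets e) (i : Fin 2) (z : ℂ) :
    logPotential h e (affinePoint i z)
      = Real.log (h.weight i z) + Real.log (∑ j, ‖localRep i (e j) z‖ ^ 2) := by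
  rw [logPotential, sum_normSq_affinePoint,
    Real.log_mul (h.weight_pos i z).ne' (he.sum_norm_sq_pos i z).ne']

theorem contDiff_log_sum_norm_sq_localRep {e : ι → HolSection (O d)} (he : SeparatesJets e)
    (i : Fin 2) : ContDiff ℝ ∞ fun z => Real.log (∑ j, ‖localRep i (e j) z‖ ^ 2) :=
  (contDiff_sum_norm_sq fun j => differentiable_localRep i (e j)).log
    fun z => (he.sum_norm_sq_pos i z).ne'

/-- `logPotential` as a smooth function on the projective line. -/
def smoothLogPotential (h : HermitianMetric (O d)) (e : ι → HolSection (O d))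
    (he : SeparatesJets e) : SmoothFun P1 :=
  ⟨logPotential h e, contMDiff_of_affine fun i => by
    simp only [logPotential_affinePoint h he]
    exact ((h.contDiff_weight i).log fun z => (h.weight_pos i z).ne').add
      (contDiff_log_sum_norm_sq_localRep he i)⟩

/-- The term `log (h.weight i)` of the potential cancels `ω`, leaving the Levi form of `log ∑ |F
j|²`. -/
theorem smoothLogPotential_mem (h : HermitianMetric (O d)) (e : ι → HolSection (O d))
    (he : SeparatesJets e) : smoothLogPotential h e he ∈ h.potentials := by
  intro x (v : ℂ) (hv : v ≠ 0)
  set i := indexAt x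
  have h1 : (fun z => smoothLogPotential h e he (affinePoint i z))
      = fun z => Real.log (h.weight i z) + Real.log (∑ j, ‖localRep i (e j) z‖ ^ 2) :=
    funext fun z => logPotential_affinePoint h he i z
  change 0 < -iddbarPlane (fun z => Real.log (h.weight i z)) (ratio i.rev i x) v (Complex.I * v)
    + iddbarPlane (fun z => smoothLogPotential h e he (affinePoint i z))
      (ratio i.rev i x) v (Complex.I * v)
  rw [h1, iddbarPlane_add ((h.contDiff_weight i).log fun z => (h.weight_pos i z).ne')
    (contDiff_log_sum_norm_sq_localRep he i), neg_add_cancel_left]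
  exact iddbarPlane_log_sum_norm_sq_pos (fun j => differentiable_localRep i (e j))
    (fun z => he i z) _ hv

/-! ### The Fubini–Study map -/

/-- Evaluation at a point is a linear functional in the orthonormal coordinates, and its squared
norm is attained at the section whose coefficients are the conjugates of the values of the `e j`.
Cauchy–Schwarz gives the upper bound. -/
theorem bergman_eq_sum [DecidableEq ι] (h : HermitianMetric (O d)) (ip : InnerProducts (O d))
    (e : Module.Basis ι ℂ (HolSection (O d)))
    (he : ∀ j k, ip.inner (e j) (e k) = if j = k then 1 else 0) (hs : SeparatesJets e) (x : P1) :
    bergman h ip x = ∑ j, h.normSq (e j x) := by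
  obtain ⟨i, z, rfl⟩ := exists_affinePoint x
  rw [sum_normSq_affinePoint]
  have hrep : ∀ s : HolSection (O d), localRep i s z = ∑ j, e.repr s j * localRep i (e j) z := by
    intro s
    conv_lhs => rw [← evalLinear_apply, ← e.sum_repr s, map_sum]
    simp only [map_smul, evalLinear_apply, smul_eq_mul]
  have hpos := hs.sum_norm_sq_pos i z
  have hip : ∀ s, (ip.inner s s).re = ∑ j, ‖e.repr s j‖ ^ 2 := core_inner_eq_of_orthonormal ip e he
  refine IsGreatest.csSup_eq ⟨?_, ?_⟩
  · set s : HolSection (O d) := ∑ j, (starRingEnd ℂ) (localRep i (e j) z) • e j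
    have hsr : ∀ j, e.repr s j = (starRingEnd ℂ) (localRep i (e j) z) := fun j => by
      simp only [s, e.repr_sum_self]
    have hsn : (ip.inner s s).re = ∑ j, ‖localRep i (e j) z‖ ^ 2 := by
      rw [hip]
      simp only [hsr, RCLike.norm_conj]
    have hsl : localRep i s z = ((∑ j, ‖localRep i (e j) z‖ ^ 2 : ℝ) : ℂ) := by
      rw [hrep]
      simp only [hsr, ← Complex.normSq_eq_conj_mul_self, Complex.normSq_eq_norm_sq]
      push_cast
      rfl
    refine ⟨s, fun h0 => ?_, ?_⟩
    · rw [h0, hip] at hsn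
      simp only [map_zero, Finsupp.coe_zero, Pi.zero_apply, norm_zero] at hsn
      simp at hsn
      linarith
    · rw [h.normSq_section, hsn, hsl, Complex.norm_real, Real.norm_of_nonneg hpos.le]
      field_simp
  · rintro _ ⟨s, hs0, rfl⟩
    have hsn : 0 < (ip.inner s s).re := by
      rw [hip]
      refine lt_of_le_of_ne (by positivity) fun h0 => hs0 ?_
      rw [eq_comm, Finset.sum_eq_zero_iff_of_nonneg fun j _ => by positivity] at h0
      exact e.ext_elem fun j => by simpa using h0 j (Finset.mem_univ j)
    rw [div_le_iff₀ hsn, h.normSq_section, mul_assoc, hip, hrep]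
    refine mul_le_mul_of_nonneg_left ?_ (h.weight_pos i z).le
    calc ‖∑ j, e.repr s j * localRep i (e j) z‖ ^ 2
        ≤ (∑ j, ‖e.repr s j‖ * ‖localRep i (e j) z‖) ^ 2 := by
          refine pow_le_pow_left₀ (norm_nonneg _) ((norm_sum_le _ _).trans_eq ?_) 2
          simp only [norm_mul]
      _ ≤ (∑ j, ‖e.repr s j‖ ^ 2) * ∑ j, ‖localRep i (e j) z‖ ^ 2 :=
          Finset.sum_mul_sq_le_sq_mul_sq _ _ _
      _ = _ := mul_comm _ _

theorem fubiniStudy_eq_logPotential [DecidableEq ι] (h : HermitianMetric (O d))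
    (ip : InnerProducts (O d)) (e : Module.Basis ι ℂ (HolSection (O d)))
    (he : ∀ j k, ip.inner (e j) (e k) = if j = k then 1 else 0) (hs : SeparatesJets e) (x : P1) :
    fubiniStudy h ip x = logPotential h e x :=
  congrArg Real.log (bergman_eq_sum h ip e he hs x)

end LogPotential

theorem separatesJets_basis {ι : Type*} (hd : 4 ≤ d) (e : Module.Basis ι ℂ (HolSection (O d))) :
    SeparatesJets e :=
  separatesJets_of_mem_span hd fun j _ => by rw [e.span_eq]; trivial

/-! ### The degenerating family `1, z, t z ^ 2, z ^ 3, …, z ^ d` -/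

/-- The sections `1, z, t z ^ 2, z ^ 3, …, z ^ d` of `O(d)`. -/
def scaledFamily (d : ℕ) (t : ℝ) (j : Fin (d + 1)) : HolSection (O d) :=
  if (j : ℕ) = 2 then (t : ℂ) • monomialBasis d j else monomialBasis d j

theorem separatesJets_scaledFamily (hd : 4 ≤ d) (t : ℝ) : SeparatesJets (scaledFamily d t) :=
  separatesJets_of_mem_span hd fun j hj => Submodule.subset_span
    ⟨j, by rw [scaledFamily, if_neg hj, monomialBasis_apply]⟩

/-- The family `scaledFamily` for `t ≠ 0` as a basis (and the monomial basis for `t = 0`). -/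
def scaledBasis (d : ℕ) (t : ℝ) : Module.Basis (Fin (d + 1)) ℂ (HolSection (O d)) :=
  (monomialBasis d).unitsSMul fun j =>
    if ht : (j : ℕ) = 2 ∧ t ≠ 0 then Units.mk0 (t : ℂ) (by exact_mod_cast ht.2) else 1

theorem scaledBasis_apply {t : ℝ} (ht : t ≠ 0) (j : Fin (d + 1)) :
    scaledBasis d t j = scaledFamily d t j := by
  rw [scaledBasis, Module.Basis.unitsSMul_apply, scaledFamily]
  by_cases hj : (j : ℕ) = 2
  · rw [dif_pos ⟨hj, ht⟩, if_pos hj]; rfl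
  · rw [dif_neg fun hh => hj hh.1, if_neg hj, one_smul]

theorem norm_sq_localRep_scaledFamily (i : Fin 2) (t : ℝ) (j : Fin (d + 1)) (z : ℂ) :
    ‖localRep i (scaledFamily d t j) z‖ ^ 2
      = (if (j : ℕ) = 2 then t ^ 2 else 1) * ‖localRep i (monomialSection d j) z‖ ^ 2 := by
  rw [scaledFamily]
  split_ifs
  · rw [← evalLinear_apply, map_smul, smul_eq_mul, norm_mul, mul_pow, Complex.norm_real,
      Real.norm_eq_abs, sq_abs, evalLinear_apply, monomialBasis_apply]
  · rw [one_mul, monomialBasis_apply]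

/-- Joint smoothness extends across `t = 0` because the scaled family has no common zero there
either, so the logarithm is never taken at `0`. -/
theorem contDiff_logPotential_scaledFamily (hd : 4 ≤ d) (h : HermitianMetric (O d)) (i : Fin 2) :
    ContDiff ℝ ∞ fun q : ℝ × ℂ => logPotential h (scaledFamily d q.1) (affinePoint i q.2) := by
  have heq := fun q : ℝ × ℂ =>
    logPotential_affinePoint h (separatesJets_scaledFamily hd q.1) i q.2
  simp only [heq]
  refine ContDiff.add (((h.contDiff_weight i).log fun z => (h.weight_pos i z).ne').comp
    contDiff_snd) (ContDiff.log ?_ fun q =>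
      ((separatesJets_scaledFamily hd q.1).sum_norm_sq_pos i q.2).ne')
  simp only [norm_sq_localRep_scaledFamily]
  refine ContDiff.sum fun j _ => ContDiff.mul ?_ ?_
  · split_ifs
    · exact contDiff_fst.pow 2
    · exact contDiff_const
  · exact (((differentiable_localRep i (monomialSection d j)).contDiff.restrict_scalars
      ℝ).norm_sq ℝ).comp contDiff_snd

/-- The potentials `log ∑ h(e, e)` of the scaled families. -/
def scaledPotential (hd : 4 ≤ d) (h : HermitianMetric (O d)) (t : ℝ) : h.potentials :=
  ⟨smoothLogPotential h (scaledFamily d t) (separatesJets_scaledFamily hd t),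
    smoothLogPotential_mem h _ _⟩

theorem scaledPotential_apply (hd : 4 ≤ d) (h : HermitianMetric (O d)) (t : ℝ) (x : P1) :
    (scaledPotential hd h t : SmoothFun P1) x = logPotential h (scaledFamily d t) x := rfl

theorem tendsto_scaledPotential (hd : 4 ≤ d) (h : HermitianMetric (O d)) :
    Filter.Tendsto (scaledPotential hd h) (𝓝 0) (𝓝 (scaledPotential hd h 0)) := by
  rw [tendsto_subtype_rng, smoothFunTopology]
  simp only [nhds_iInf, nhds_induced, Filter.tendsto_iInf, Filter.tendsto_comap_iff]
  rintro _ ⟨i, rfl⟩ n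
  rw [UniformOnFun.tendsto_iff_tendstoUniformlyOn]
  rintro K ⟨hK, -⟩
  exact tendstoUniformlyOn_of_continuous
    (f := fun t => iteratedFDeriv ℝ n fun z => logPotential h (scaledFamily d t) (affinePoint i z))
    (contDiff_iteratedFDeriv_param
      (f := fun t z => logPotential h (scaledFamily d t) (affinePoint i z))
      (contDiff_logPotential_scaledFamily hd h i) n).continuous 0 hK

/-- Equality of potentials gives `∑ |F j|² = ∑_{k ≠ 2} |z|^(2k)` for an orthonormal basis. The
missing `|z|⁴` forces every basis element to have no `z²` term. -/
theorem scaledPotential_zero_notMem (hd : 4 ≤ d) (h : HermitianMetric (O d)) :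
    (scaledPotential hd h 0 : SmoothFun P1) ∉ fubiniStudyRange h := by
  rintro ⟨ip, hip⟩
  obtain ⟨e, he⟩ := exists_orthonormal_basis_core ip
  have hs := separatesJets_basis hd e
  have hs0 := separatesJets_scaledFamily hd 0
  set a : Fin (Module.finrank ℂ (HolSection (O d))) → ℕ → ℂ := fun j k =>
    if hk : k < d + 1 then (monomialBasis d).repr (e j) ⟨k, hk⟩ else 0 with ha
  have hrep : ∀ j z, localRep 1 (e j) z = ∑ k ∈ Finset.range (d + 1), a j k * z ^ k := by
    intro j z
    conv_lhs => rw [← evalLinear_apply, ← (monomialBasis d).sum_repr (e j), map_sum]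
    rw [Finset.sum_range]
    refine Finset.sum_congr rfl fun k _ => ?_
    rw [map_smul, evalLinear_apply, monomialBasis_apply, localRep_monomialSection, if_pos rfl,
      smul_eq_mul, ha]
    simp only [k.isLt, dif_pos]
  have hsum : ∀ z : ℂ, ∑ j, ‖∑ k ∈ Finset.range (d + 1), a j k * z ^ k‖ ^ 2
      = ∑ k ∈ Finset.range (d + 1), (if k = 2 then (0 : ℝ) else 1) * (‖z‖ ^ 2) ^ k := by
    intro z
    have h1 := hip (affinePoint 1 z)
    rw [fubiniStudy_eq_logPotential h ip e he hs, scaledPotential_apply,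
      logPotential_affinePoint h hs0, logPotential_affinePoint h hs] at h1
    -- The weight of `h` drops out, so the metric plays no role from here on.
    have h2 := Real.log_injOn_pos (hs0.sum_norm_sq_pos 1 z) (hs.sum_norm_sq_pos 1 z)
      (add_left_cancel h1)
    simp only [← hrep]
    rw [← h2, Finset.sum_range]
    refine Finset.sum_congr rfl fun k _ => ?_
    rw [norm_sq_localRep_scaledFamily, localRep_monomialSection, if_pos rfl, norm_pow, ← pow_mul,
      ← pow_mul, mul_comm (k : ℕ) 2]
    simp
  have h2 := sum_norm_sq_coeff_eq (d + 1) a _ hsum (k := 2) (by omega)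
  rw [if_pos rfl, Finset.sum_eq_zero_iff_of_nonneg fun j _ => by positivity] at h2
  -- The `z²`-coordinate vanishes on a basis, hence identically, yet it equals `1` on `s₂`.
  have hcoord : (monomialBasis d).coord ⟨2, by omega⟩ = 0 := e.ext fun j => by
    have := h2 j (Finset.mem_univ j)
    rw [sq_eq_zero_iff, norm_eq_zero, ha] at this
    simpa [show 2 < d + 1 by omega] using this
  have := LinearMap.congr_fun hcoord (monomialBasis d ⟨2, by omega⟩)
  simp at this

end FubiniStudy

end

open FubiniStudy in
/-- On `O(d) → ℙ¹`, `d ≥ 4`, with any smooth hermitian metric, `FS(𝓗_E) ⊆ 𝓗_ω` is not relatively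
closed; the witness is the limit, as `t → 0`, of the images under `FS` of the inner products for
which `1, z, t z², z³, …, z^d` form an orthonormal basis. -/
theorem mainTheorem5 (d : ℕ) (hd : 4 ≤ d) (h : HermitianMetric (O d)) :
    -- FS maps into `𝓗_ω ⊆ C^∞(X)`
    (∀ ip : InnerProducts (O d), ∃ u ∈ h.potentials, ∀ x, u x = fubiniStudy h ip x) ∧
    -- its image is not relatively closed in `𝓗_ω`
    ¬ IsClosed {u : h.potentials | (u : SmoothFun P1) ∈ fubiniStudyRange h} ∧
    -- the sections `1, z, z², …, z^d` form a basis of `𝓞(E)`, and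
    ∃ b : Module.Basis (Fin (d + 1)) ℂ (HolSection (O d)),
      (∀ (j : Fin (d + 1)) (z : ℂ),
        ((bundleO d).localTriv 1 ⟨affinePoint 1 z, b j (affinePoint 1 z)⟩).2 = z ^ (j : ℕ)) ∧
      -- the inner products that make `1, z, t z², z³, …, z^d` orthonormal, `t > 0`,
      ∃ ip : ℝ → InnerProducts (O d),
        (∀ t : ℝ, 0 < t → ∀ j k : Fin (d + 1),
          (ip t).inner (if (j : ℕ) = 2 then (t : ℂ) • b j else b j)
            (if (k : ℕ) = 2 then (t : ℂ) • b k else b k) = if j = k then 1 else 0) ∧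
        -- have FS images that converge in `𝓗_ω` to a potential `u₀` that is not in the image of FS
        ∃ (u : ℝ → h.potentials) (u₀ : h.potentials),
          (∀ t : ℝ, 0 < t → ∀ x, (u t : SmoothFun P1) x = fubiniStudy h (ip t) x) ∧
          (∀ x, (u₀ : SmoothFun P1) x =
            Real.log (∑ j : Fin (d + 1), if (j : ℕ) = 2 then 0 else h.normSq (b j x))) ∧
          Filter.Tendsto u (𝓝[>] 0) (𝓝 u₀) ∧
          (u₀ : SmoothFun P1) ∉ fubiniStudyRange h := by
  have hortho : ∀ t : ℝ, ∀ j k, (coreOfBasis (scaledBasis d t)).inner (scaledBasis d t j)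
      (scaledBasis d t k) = if j = k then 1 else 0 := fun t => coreOfBasis_inner _
  have hFS : ∀ t : ℝ, 0 < t → ∀ x, (scaledPotential hd h t : SmoothFun P1) x
      = fubiniStudy h (coreOfBasis (scaledBasis d t)) x := fun t ht x => by
    rw [fubiniStudy_eq_logPotential h _ _ (hortho t) (separatesJets_basis hd _),
      scaledPotential_apply, funext (scaledBasis_apply (d := d) ht.ne')]
  have hlim := (tendsto_scaledPotential hd h).mono_left (nhdsWithin_le_nhds (s := Set.Ioi 0))
  have hnot := scaledPotential_zero_notMem hd h
  refine ⟨fun ip => ?_, fun hc => ?_, monomialBasis d, fun j z => ?_,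
    fun t => coreOfBasis (scaledBasis d t), fun t ht j k => ?_, scaledPotential hd h,
    scaledPotential hd h 0, hFS, fun x => ?_, hlim, hnot⟩
  · obtain ⟨e, he⟩ := exists_orthonormal_basis_core ip
    have hs := separatesJets_basis hd e
    exact ⟨smoothLogPotential h e hs, smoothLogPotential_mem h e hs, fun x =>
      (fubiniStudy_eq_logPotential h ip e he hs x).symm⟩
  · refine hnot (hc.mem_of_tendsto hlim ?_)
    filter_upwards [self_mem_nhdsWithin] with t ht
    exact ⟨_, hFS t ht⟩
  · rw [monomialBasis_apply]
    exact (localRep_monomialSection 1 j z).trans (if_pos rfl)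
  · have := hortho t j k
    rwa [scaledBasis_apply ht.ne', scaledBasis_apply ht.ne'] at this
  · rw [scaledPotential_apply, logPotential]
    congr 1
    refine Finset.sum_congr rfl fun j _ => ?_
    obtain ⟨i, z, rfl⟩ := exists_affinePoint x
    rw [h.normSq_section, h.normSq_section, norm_sq_localRep_scaledFamily, monomialBasis_apply]
    split_ifs <;> simp
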